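/- Let $F:\mathbb R\times\mathbb R^n\to\mathbb R^n$ and consider $\dot x=F(t,x)$. A solution with initial condition $(t_\circ,x_\circ)$ is a function $x$ on an interval $J$ with left endpoint $t_\circ\in J$ such that $s\mapsto F(s,x(s))$ is integrable on $[t_\circ,t]$ and $x(t)=x_\circ+\int_{t_\circ}^tF(s,x(s))\,ds$ for all $t\in J$. Write $\mathcal B(r)=\{x\in\mathbb R^n:|x|\le r\}$, with $|\cdot|$ the Euclidean norm. The origin is *uniformly globally stable (UGS)* if every solution can be continued to $[t_\circ,\infty)$ and there is a continuous, strictly increasing, unbounded $\gamma:[0,\infty)\to[0,\infty)$ with $\gamma(0)=0$ such that $|x(t)|\le\gamma(|x_\circ|)$ for all $(t_\circ,x_\circ)\in\mathbb R\times\mathbb R^n$, all solutions $x$ on $[t_\circ,\infty)$ with that initial condition, and all $t\ge t_\circ$. It is *uniformly globally asymptotically stable (UGAS)* if it is UGS and, for all $r,\sigma>0$, there is $T>0$ such that, for every $t_\circ\in\mathbb R$ and $|x_\circ|\le r$, every solution $x$ on $[t_\circ,\infty)$ satisfies $|x(t)|\le\sigma$ for all $t\ge t_\circ+T$. Suppose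 the following. 1. The origin is UGS. 2. For each $\Delta>0$ there exist a number $\mu>0$, a locally Lipschitz function $V:\mathbb R\times\mathbb R^n\to\mathbb R$ and a continuous function $Y:\mathbb R^n\times\mathbb R^n\to\mathbb R$ such that: (a) for almost all $(t,x)\in\mathbb R\times\mathcal B(\Delta)$, $$\max\{|V(t,x)|,|F(t,x)|\}\le\mu,\qquad \dot V(t,x):=\frac{\partial V}{\partial t}(t,x)+\frac{\partial V}{\partial x}(t,x)F(t,x)\le Y(x,F(t,x));$$ (b) $Y(z,\psi)\le0$ for all $(z,\psi)\in\mathcal B(\Delta)\times\mathcal B(\mu)$; (c) if $(z,\psi)\in\mathcal B(\Delta)\times\mathcal B(\mu)$ and $Y(z,\psi)=0$, then $\psi=0$. 3. $F$ is locally Lipschitz in $x$ uniformly in $t$: each $x_0\in\mathbb R^n$ has a neighbourhood $U$ and a constant $L$ such that $|F(t,x)-F(t,y)|\le L|x-y|$ for all $x,y\in U$ and all $t\in\mathbb R$. 4. $F$ is uniformly $\delta$-persistently exciting (u$\delta$-PE) with respect to $x$: $t\mapsto F(t,x)$ is locally integrable for each $x$, and for each $x\ne0$ there exist $\delta,T,\mu>0$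 such that, for all $t\in\mathbb R$ and all $z$ with $|z-x|\le\delta$, $\int_t^{t+T}|F(\tau,z)|\,d\tau\ge\mu$. Then the origin of $\dot x=F(t,x)$ is UGAS. -/

import Mathlib

open MeasureTheory Set Filter Topology

/-- Class `𝒦∞`: continuous and strictly increasing on `[0, ∞)`, zero at zero, unbounded. -/
structure IsClassKInfty (γ : ℝ → ℝ) : Prop where
  continuousOn : ContinuousOn γ (Ici 0)
  strictMonoOn : StrictMonoOn γ (Ici 0)
  map_zero : γ 0 = 0
  tendsto_atTop : Tendsto γ atTop atTop

/-- `x` solves `ẋ = F(t, x)`, `x(t₀) = x₀` on the interval `J`, whose left endpoint is `t₀ ∈ J`,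
in the sense of Carathéodory: `x(t) = x₀ + ∫_{t₀}^t F(s, x(s)) ds` for all `t ∈ J`.
Only the values of `x` on `J` matter. -/
structure IsSolutionOn {n : ℕ}
    (F : ℝ → EuclideanSpace ℝ (Fin n) → EuclideanSpace ℝ (Fin n))
    (t₀ : ℝ) (x₀ : EuclideanSpace ℝ (Fin n)) (J : Set ℝ)
    (x : ℝ → EuclideanSpace ℝ (Fin n)) : Prop where
  ordConnected : J.OrdConnected
  left_mem : t₀ ∈ J
  subset_Ici : J ⊆ Ici t₀
  intervalIntegrable : ∀ t ∈ J, IntervalIntegrable (fun s => F s (x s)) volume t₀ t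
  eq_integral : ∀ t ∈ J, x t = x₀ + ∫ s in t₀..t, F s (x s)

/-- Every solution can be continued to all future times. (As the constant `x₀` is a
solution on `{t₀}`, this contains the existence of a solution on `[t₀, ∞)` from every `x₀`.) -/
def IsForwardComplete {n : ℕ}
    (F : ℝ → EuclideanSpace ℝ (Fin n) → EuclideanSpace ℝ (Fin n)) : Prop :=
  ∀ (t₀ : ℝ) (x₀ : EuclideanSpace ℝ (Fin n)) (J : Set ℝ) (x : ℝ → EuclideanSpace ℝ (Fin n)),
    IsSolutionOn F t₀ x₀ J x →
      ∃ y : ℝ → EuclideanSpace ℝ (Fin n), IsSolutionOn F t₀ x₀ (Ici t₀) y ∧ EqOn x y J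

/-- Uniform global stability of the origin: all (continued) solutions are defined for all
`t ≥ t₀` and satisfy `‖x(t)‖ ≤ γ(‖x₀‖)` there. -/
def IsUGS {n : ℕ}
    (F : ℝ → EuclideanSpace ℝ (Fin n) → EuclideanSpace ℝ (Fin n)) : Prop :=
  IsForwardComplete F ∧
    ∃ γ : ℝ → ℝ, IsClassKInfty γ ∧
      ∀ (t₀ : ℝ) (x₀ : EuclideanSpace ℝ (Fin n)) (x : ℝ → EuclideanSpace ℝ (Fin n)),
        IsSolutionOn F t₀ x₀ (Ici t₀) x → ∀ t, t₀ ≤ t → ‖x t‖ ≤ γ ‖x₀‖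

/-- Uniform global attractivity of the origin. -/
def IsUniformlyGloballyAttractive {n : ℕ}
    (F : ℝ → EuclideanSpace ℝ (Fin n) → EuclideanSpace ℝ (Fin n)) : Prop :=
  ∀ r > (0 : ℝ), ∀ σ > (0 : ℝ), ∃ T > (0 : ℝ),
    ∀ (t₀ : ℝ) (x₀ : EuclideanSpace ℝ (Fin n)) (x : ℝ → EuclideanSpace ℝ (Fin n)),
      IsSolutionOn F t₀ x₀ (Ici t₀) x → ‖x₀‖ ≤ r → ∀ t, t₀ + T ≤ t → ‖x t‖ ≤ σ

/-- Uniform global asymptotic stability of the origin. -/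
def IsUGAS {n : ℕ}
    (F : ℝ → EuclideanSpace ℝ (Fin n) → EuclideanSpace ℝ (Fin n)) : Prop :=
  IsUGS F ∧ IsUniformlyGloballyAttractive F

/-- `φ` is locally Lipschitz in `x` uniformly in `t`. -/
def LocallyLipschitzUniformlyInTime {n m : ℕ}
    (φ : ℝ → EuclideanSpace ℝ (Fin n) → EuclideanSpace ℝ (Fin m)) : Prop :=
  ∀ x₀ : EuclideanSpace ℝ (Fin n), ∃ L : ℝ, ∃ U ∈ 𝓝 x₀,
    ∀ x ∈ U, ∀ y ∈ U, ∀ t : ℝ, ‖φ t x - φ t y‖ ≤ L * ‖x - y‖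

/-- `φ` is uniformly δ-persistently exciting with respect to the whole state `x`. -/
def IsUDeltaPE {n m : ℕ}
    (φ : ℝ → EuclideanSpace ℝ (Fin n) → EuclideanSpace ℝ (Fin m)) : Prop :=
  (∀ x, LocallyIntegrable (fun t => φ t x) volume) ∧
    ∀ x : EuclideanSpace ℝ (Fin n), x ≠ 0 →
      ∃ δ > (0 : ℝ), ∃ T > (0 : ℝ), ∃ μ > (0 : ℝ), ∀ (t : ℝ) (z : EuclideanSpace ℝ (Fin n)),
        ‖z - x‖ ≤ δ → μ ≤ ∫ τ in t..(t + T), ‖φ τ z‖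

/-- The total derivative `V̇(t, x) = ∂V/∂t + (∂V/∂x) F(t, x)` of `V` along `ẋ = F(t, x)`.
For locally Lipschitz `V` it is meaningful at almost every `(t, x)` (Rademacher), and it is only
used there. -/
noncomputable def totalDeriv {n : ℕ}
    (F : ℝ → EuclideanSpace ℝ (Fin n) → EuclideanSpace ℝ (Fin n))
    (V : ℝ × EuclideanSpace ℝ (Fin n) → ℝ) (t : ℝ) (x : EuclideanSpace ℝ (Fin n)) : ℝ :=
  deriv (fun s => V (s, x)) t + fderiv ℝ (fun y => V (t, y)) x (F t x)

/-! By UGS it suffices that a solution, confined to the ball of radius `R = γ r`, enters a small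
ball of radius `η` within a uniform time. While it stays outside, excitation at the frozen state `x
t` forces `∫ ‖F τ (x τ)‖ ≥ a` on each window of length `T`: the solution either moves by `ρ` or
remains so close to `x t` that it inherits half of the excitation (`le_integral_norm`). Compactness
turns the zero condition on `Y` into `‖ψ‖ ≤ ε + K * -Y` (`exists_norm_le_add_mul`), so `∫ Y ≤ -a /
(2K)` per window. As `V` decreases at least as fast as `∫ Y` (`lyapunov_sub_le`) and `|V| ≤ μ`, this
cannot go on for long.

The delicate point is that the bound on `V̇` holds only almost everywhere in `(t, x)`, while the
graph of a solution may be a null set. The graph is therefore shifted by a small generic vector. -/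

lemma forall_mem_le_of_ae {X : Type*} [TopologicalSpace X] [MeasurableSpace X] {ν : Measure X}
    [ν.IsOpenPosMeasure] {f : X → ℝ} (hf : Continuous f) {U : Set X} (hU : IsOpen U) {c : ℝ}
    (h : ∀ᵐ x ∂ν, x ∈ U → f x ≤ c) : ∀ x ∈ U, f x ≤ c := by
  intro x hx
  by_contra! hc
  obtain ⟨y, ⟨hyU, hyc⟩, hy⟩ := (Measure.dense_of_ae h).inter_open_nonempty
    (U ∩ {y | c < f y}) (hU.inter (isOpen_lt continuous_const hf)) ⟨x, hx, hc⟩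
  exact absurd (hy hyU) (not_le.2 hyc)

/-! ### Uniformity in time, from compactness -/

section LipschitzField

variable {n m : ℕ} {φ : ℝ → EuclideanSpace ℝ (Fin n) → EuclideanSpace ℝ (Fin m)}

/-- The maps `φ t`, indexed by time, are equicontinuous; on a compact ball this becomes uniform. -/
lemma LocallyLipschitzUniformlyInTime.exists_uniform_modulus
    (h : LocallyLipschitzUniformlyInTime φ) (R : ℝ) {ε : ℝ} (hε : 0 < ε) :
    ∃ ρ > 0, ∀ x y : EuclideanSpace ℝ (Fin n), ‖x‖ ≤ R → ‖y‖ ≤ R → ‖x - y‖ ≤ ρ →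
      ∀ t, ‖φ t x - φ t y‖ ≤ ε := by
  have hequi : Equicontinuous
      (fun t (x : Metric.closedBall (0 : EuclideanSpace ℝ (Fin n)) R) => φ t x) := by
    intro x₀
    obtain ⟨L, U, hU, hL⟩ := h x₀
    rw [Metric.equicontinuousAt_iff_right]
    intro δ hδ
    have hcont : Tendsto (fun x : Metric.closedBall (0 : EuclideanSpace ℝ (Fin n)) R =>
        L * ‖(x₀ : EuclideanSpace ℝ (Fin n)) - x‖) (𝓝 x₀) (𝓝 0) := by
      have : Continuous (fun x : Metric.closedBall (0 : EuclideanSpace ℝ (Fin n)) R =>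
        L * ‖(x₀ : EuclideanSpace ℝ (Fin n)) - x‖) := by fun_prop
      simpa using this.tendsto x₀
    filter_upwards [hcont.eventually (gt_mem_nhds hδ),
      continuous_subtype_val.continuousAt.preimage_mem_nhds hU] with x hx hxU t
    rw [dist_eq_norm]
    exact (hL _ (mem_of_mem_nhds hU) _ hxU t).trans_lt hx
  have hu := CompactSpace.uniformEquicontinuous_of_equicontinuous hequi
  rw [Metric.uniformEquicontinuous_iff] at hu
  obtain ⟨ρ, hρ, H⟩ := hu ε hε
  refine ⟨ρ / 2, by positivity, fun x y hx hy hxy t => ?_⟩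
  have := H ⟨x, by simpa using hx⟩ ⟨y, by simpa using hy⟩
    (by rw [Subtype.dist_eq, dist_eq_norm]; exact hxy.trans_lt (by linarith)) t
  rw [dist_eq_norm] at this
  exact this.le

lemma LocallyLipschitzUniformlyInTime.continuous (h : LocallyLipschitzUniformlyInTime φ) (t : ℝ) :
    Continuous (φ t) := by
  refine Metric.continuous_iff.2 fun y ε hε => ?_
  obtain ⟨ρ, hρ, H⟩ := h.exists_uniform_modulus (‖y‖ + 1) (half_pos hε)
  refine ⟨min ρ 1, by positivity, fun x hx => ?_⟩
  rw [dist_eq_norm] at hx ⊢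
  have h1 := (lt_min_iff.1 hx).1
  have h2 := (lt_min_iff.1 hx).2
  have h3 : ‖x‖ ≤ ‖y‖ + 1 := by
    have := norm_sub_norm_le x y
    linarith
  have := H x y h3 (by linarith) h1.le t
  linarith

lemma ae_forall_norm_le (h : LocallyLipschitzUniformlyInTime φ) {Δ μ : ℝ}
    (hae : ∀ᵐ p : ℝ × EuclideanSpace ℝ (Fin n) ∂volume, ‖p.2‖ ≤ Δ → ‖φ p.1 p.2‖ ≤ μ) :
    ∀ᵐ t : ℝ, ∀ x, ‖x‖ < Δ → ‖φ t x‖ ≤ μ := by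
  rw [Measure.volume_eq_prod] at hae
  filter_upwards [Measure.ae_ae_of_ae_prod hae] with t ht x hx
  refine forall_mem_le_of_ae (ν := volume) (h.continuous t).norm
    (U := Metric.ball (0 : EuclideanSpace ℝ (Fin n)) Δ) Metric.isOpen_ball ?_ x (by simpa using hx)
  filter_upwards [ht] with y hy hyU
  exact hy (by simpa using (mem_ball_zero_iff.1 hyU).le)

lemma IsUDeltaPE.exists_uniform_of_annulus (h : IsUDeltaPE φ) {η : ℝ} (hη : 0 < η) (R : ℝ) :
    ∃ T > 0, ∃ c > 0, ∀ z : EuclideanSpace ℝ (Fin n), η ≤ ‖z‖ → ‖z‖ ≤ R → ∀ t : ℝ,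
      c ≤ ∫ τ in t..(t + T), ‖φ τ z‖ := by
  obtain ⟨hint, hpe⟩ := h
  have hK : IsCompact
      ({z | η ≤ ‖z‖} ∩ Metric.closedBall (0 : EuclideanSpace ℝ (Fin n)) R) :=
    (isCompact_closedBall _ _).inter_left (isClosed_le continuous_const continuous_norm)
  have hmono : ∀ (z : EuclideanSpace ℝ (Fin n)) (t : ℝ) {T T' : ℝ}, 0 < T → T ≤ T' →
      ∫ τ in t..(t + T), ‖φ τ z‖ ≤ ∫ τ in t..(t + T'), ‖φ τ z‖ := by
    intro z t T T' hT hTT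
    refine intervalIntegral.integral_mono_interval le_rfl (by linarith) (by linarith)
      (Eventually.of_forall fun _ => norm_nonneg _) ?_
    exact ((hint z).integrableOn_isCompact isCompact_uIcc).intervalIntegrable.norm
  have key : ∃ T > 0, ∃ c > 0,
      ∀ z ∈ {z | η ≤ ‖z‖} ∩ Metric.closedBall (0 : EuclideanSpace ℝ (Fin n)) R, ∀ t : ℝ,
        c ≤ ∫ τ in t..(t + T), ‖φ τ z‖ := by
    refine hK.induction_on (p := fun S => ∃ T > 0, ∃ c > 0, ∀ z ∈ S, ∀ t : ℝ,
        c ≤ ∫ τ in t..(t + T), ‖φ τ z‖) ?_ ?_ ?_ ?_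
    · exact ⟨1, one_pos, 1, one_pos, by simp⟩
    · rintro s t hst ⟨T, hT, c, hc, H⟩
      exact ⟨T, hT, c, hc, fun z hz => H z (hst hz)⟩
    · rintro s t ⟨T, hT, c, hc, H⟩ ⟨T', hT', c', hc', H'⟩
      -- Lengthening the window is harmless because the integrand is nonnegative.
      refine ⟨max T T', by positivity, min c c', by positivity, fun z hz t => ?_⟩
      rcases hz with hz | hz
      · exact (min_le_left _ _).trans ((H z hz t).trans (hmono z t hT (le_max_left _ _)))
      · exact (min_le_right _ _).trans ((H' z hz t).trans (hmono z t hT' (le_max_right _ _)))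
    · rintro x ⟨hx, -⟩
      obtain ⟨δ, hδ, T, hT, c, hc, H⟩ := hpe x (norm_pos_iff.1 (hη.trans_le hx))
      exact ⟨Metric.closedBall x δ, mem_nhdsWithin_of_mem_nhds (Metric.closedBall_mem_nhds x hδ),
        T, hT, c, hc, fun z hz t => H t z (by simpa [dist_eq_norm] using hz)⟩
  obtain ⟨T, hT, c, hc, H⟩ := key
  exact ⟨T, hT, c, hc, fun z h1 h2 t => H z ⟨h1, by simpa using h2⟩ t⟩

end LipschitzField

/-- A nonpositive continuous function vanishing only where `ψ = 0` controls `‖ψ‖` up to `ε`. -/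
lemma exists_norm_le_add_mul {E : Type*} [NormedAddCommGroup E] [ProperSpace E] {Y : E × E → ℝ}
    (hY : Continuous Y) {Δ μ : ℝ} (hnonpos : ∀ z ψ : E, ‖z‖ ≤ Δ → ‖ψ‖ ≤ μ → Y (z, ψ) ≤ 0)
    (hzero : ∀ z ψ : E, ‖z‖ ≤ Δ → ‖ψ‖ ≤ μ → Y (z, ψ) = 0 → ψ = 0) {ε : ℝ} (hε : 0 < ε) :
    ∃ K > 0, ∀ z ψ : E, ‖z‖ ≤ Δ → ‖ψ‖ ≤ μ → ‖ψ‖ ≤ ε + K * -Y (z, ψ) := by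
  set C : Set (E × E) :=
    {p | ε ≤ ‖p.2‖} ∩ Metric.closedBall (0 : E) Δ ×ˢ Metric.closedBall (0 : E) μ with hC
  have hCc : IsCompact C :=
    ((isCompact_closedBall _ _).prod (isCompact_closedBall _ _)).inter_left
      (isClosed_le continuous_const (by fun_prop))
  have hneg : ∀ p ∈ C, 0 < -Y p := by
    rintro ⟨z, ψ⟩ ⟨h1, h2, h3⟩
    have h2 : ‖z‖ ≤ Δ := by simpa using h2
    have h3 : ‖ψ‖ ≤ μ := by simpa using h3
    refine neg_pos.2 (lt_of_le_of_ne (hnonpos z ψ h2 h3) fun h0 => ?_)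
    have := hzero z ψ h2 h3 h0
    simp only [mem_ofPred_eq, this, norm_zero] at h1
    linarith
  -- Where `‖ψ‖ ≥ ε`, `Y` is strictly negative; `K` bounds this quotient on a compact set.
  have hcont : ContinuousOn (fun p : E × E => ‖p.2‖ / -Y p) C :=
    ContinuousOn.div (by fun_prop) (by fun_prop) fun p hp => (hneg p hp).ne'
  obtain ⟨K, hK⟩ := hCc.bddAbove_image hcont
  refine ⟨max K 1, by positivity, fun z ψ hz hψ => ?_⟩
  have hYn : 0 ≤ -Y (z, ψ) := neg_nonneg.2 (hnonpos z ψ hz hψ)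
  rcases le_total ‖ψ‖ ε with h | h
  · have : 0 ≤ max K 1 * -Y (z, ψ) := by positivity
    linarith
  · have hp : (z, ψ) ∈ C := ⟨h, by simpa using hz, by simpa using hψ⟩
    have h1 : ‖ψ‖ / -Y (z, ψ) ≤ K := hK ⟨_, hp, rfl⟩
    have h2 := (div_le_iff₀ (hneg _ hp)).1 (h1.trans (le_max_left K 1))
    linarith

/-! ### Carathéodory solutions -/

section Solution

variable {n : ℕ} {F : ℝ → EuclideanSpace ℝ (Fin n) → EuclideanSpace ℝ (Fin n)} {t₀ : ℝ}
  {x₀ : EuclideanSpace ℝ (Fin n)} {x : ℝ → EuclideanSpace ℝ (Fin n)}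

lemma IsSolutionOn.intervalIntegrable_of_le (h : IsSolutionOn F t₀ x₀ (Ici t₀) x) {s t : ℝ}
    (hs : t₀ ≤ s) (ht : t₀ ≤ t) : IntervalIntegrable (fun s => F s (x s)) volume s t :=
  (h.intervalIntegrable s hs).symm.trans (h.intervalIntegrable t ht)

lemma IsSolutionOn.sub_eq_integral (h : IsSolutionOn F t₀ x₀ (Ici t₀) x) {s t : ℝ}
    (hs : t₀ ≤ s) (ht : t₀ ≤ t) : x t - x s = ∫ τ in s..t, F τ (x τ) := by
  rw [h.eq_integral t ht, h.eq_integral s hs, add_sub_add_left_eq_sub,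
    intervalIntegral.integral_interval_sub_left (h.intervalIntegrable t ht)
      (h.intervalIntegrable s hs)]

lemma IsSolutionOn.restart (h : IsSolutionOn F t₀ x₀ (Ici t₀) x) {s : ℝ} (hs : t₀ ≤ s) :
    IsSolutionOn F s (x s) (Ici s) x where
  ordConnected := ordConnected_Ici
  left_mem := self_mem_Ici
  subset_Ici := subset_rfl
  intervalIntegrable t ht := h.intervalIntegrable_of_le hs (hs.trans ht)
  eq_integral t ht := by rw [← h.sub_eq_integral hs (hs.trans ht), add_sub_cancel]

lemma IsSolutionOn.lipschitzOnWith (h : IsSolutionOn F t₀ x₀ (Ici t₀) x) {μ : NNReal}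
    (hb : ∀ᵐ t : ℝ, t₀ ≤ t → ‖F t (x t)‖ ≤ μ) : LipschitzOnWith μ x (Ici t₀) := by
  refine LipschitzOnWith.of_dist_le_mul fun t ht s hs => ?_
  rw [dist_eq_norm, h.sub_eq_integral hs ht, Real.dist_eq]
  refine intervalIntegral.norm_integral_le_of_norm_le_const_ae ?_
  filter_upwards [hb] with τ hτ hmem
  exact hτ ((le_min hs ht).trans hmem.1.le)

lemma IsSolutionOn.ae_hasDerivAt (h : IsSolutionOn F t₀ x₀ (Ici t₀) x) (b : ℝ) :
    ∀ᵐ t : ℝ, t ∈ Ioo t₀ b → HasDerivAt x (F t (x t)) t := by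
  rcases le_or_gt b t₀ with hb | hb
  · simp [Ioo_eq_empty (not_lt.2 hb)]
  filter_upwards [(h.intervalIntegrable b hb.le).ae_hasDerivAt_integral] with t ht hmem
  have h1 := (ht (uIcc_of_le hb.le ▸ Ioo_subset_Icc_self hmem) t₀ left_mem_uIcc).const_add x₀
  refine h1.congr_of_eventuallyEq ?_
  filter_upwards [Ioi_mem_nhds hmem.1] with s hs
  exact h.eq_integral s (mem_Ici.2 (le_of_lt hs))

end Solution

/-! ### Lyapunov decrease and excitation along solutions -/

section Lyapunov

variable {n : ℕ} {F : ℝ → EuclideanSpace ℝ (Fin n) → EuclideanSpace ℝ (Fin n)} {t₀ : ℝ}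
  {x₀ : EuclideanSpace ℝ (Fin n)} {x : ℝ → EuclideanSpace ℝ (Fin n)}

lemma totalDeriv_eq_fderiv {V : ℝ × EuclideanSpace ℝ (Fin n) → ℝ} {t : ℝ}
    {y : EuclideanSpace ℝ (Fin n)} (hV : DifferentiableAt ℝ V (t, y)) :
    totalDeriv F V t y = fderiv ℝ V (t, y) (1, F t y) := by
  have h1 : HasDerivAt (fun s => V (s, y)) (fderiv ℝ V (t, y) (1, 0)) t :=
    hV.hasFDerivAt.comp_hasDerivAt t ((hasDerivAt_id t).prodMk (hasDerivAt_const t y))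
  have h2 : HasFDerivAt (fun z => V (t, z)) _ y :=
    hV.hasFDerivAt.comp y (hasFDerivAt_prodMk_right t y)
  rw [totalDeriv, h1.deriv, h2.fderiv]
  simp only [ContinuousLinearMap.comp_apply, ContinuousLinearMap.inr_apply, ← map_add,
    Prod.mk_add_mk, add_zero, zero_add]

lemma IsSolutionOn.intervalIntegrable_comp (h : IsSolutionOn F t₀ x₀ (Ici t₀) x)
    {Y : EuclideanSpace ℝ (Fin n) × EuclideanSpace ℝ (Fin n) → ℝ} (hY : Continuous Y) {R μ : ℝ}
    (hR : ∀ t, t₀ ≤ t → ‖x t‖ ≤ R) (hb : ∀ᵐ t : ℝ, t₀ ≤ t → ‖F t (x t)‖ ≤ μ)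
    (hx : ContinuousOn x (Ici t₀)) {s t : ℝ} (hs : t₀ ≤ s) (ht : t₀ ≤ t) :
    IntervalIntegrable (fun τ => Y (x τ, F τ (x τ))) volume s t := by
  obtain ⟨C, hC⟩ := ((isCompact_closedBall (0 : EuclideanSpace ℝ (Fin n)) R).prod
    (isCompact_closedBall (0 : EuclideanSpace ℝ (Fin n)) μ)).exists_bound_of_continuousOn
      hY.continuousOn
  have hsub : uIoc s t ⊆ Ici t₀ := fun τ hτ => (le_min hs ht).trans hτ.1.le
  rw [intervalIntegrable_iff]
  have : IsFiniteMeasure (volume.restrict (uIoc s t)) := ⟨by simp [uIoc]⟩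
  refine Integrable.of_bound (C := C) ?_ ?_
  · exact hY.comp_aestronglyMeasurable
      (((hx.mono hsub).aestronglyMeasurable measurableSet_uIoc).prodMk
        (intervalIntegrable_iff.1 (h.intervalIntegrable_of_le hs ht)).aestronglyMeasurable)
  · filter_upwards [ae_restrict_of_ae hb, ae_restrict_mem measurableSet_uIoc] with τ h1 h2
    exact hC _ ⟨by simpa using hR τ (hsub h2), by simpa using h1 (hsub h2)⟩

/-- The graph of a curve, translated by almost every constant vector, meets a conull set at
almost every time. -/
lemma ae_ae_translate_mem {E : Type*} [NormedAddCommGroup E] [MeasurableSpace E] [BorelSpace E]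
    [SecondCountableTopology E] {ν : Measure E} [SFinite ν] [ν.IsAddLeftInvariant] {y : ℝ → E}
    (hy : Continuous y) {P : ℝ × E → Prop} (hP : ∀ᵐ p ∂((volume : Measure ℝ).prod ν), P p) :
    ∀ᵐ w ∂ν, ∀ᵐ s : ℝ, P (s, y s + w) := by
  -- This shear preserves the product measure, so Fubini applies to the pulled-back conull set.
  have h1 : MeasurePreserving (fun p : ℝ × E => (p.1, y p.1 + p.2))
      ((volume : Measure ℝ).prod ν) ((volume : Measure ℝ).prod ν) :=
    (MeasurePreserving.id volume).skew_product (g := fun s w => y s + w)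
      (by
        have : Continuous (Function.uncurry fun (s : ℝ) (w : E) => y s + w) := by
          unfold Function.uncurry; fun_prop
        exact this.measurable)
      (Eventually.of_forall fun s => map_add_left_eq_self ν (y s))
  have h2 := (h1.comp (Measure.measurePreserving_swap (μ := ν) (ν := volume)))
  exact Measure.ae_ae_of_ae_prod (h2.quasiMeasurePreserving.ae hP)

/-- Along `x + w`, for almost every `w`, `V` is differentiable and the bound on `V̇` holds at almost
every time. Integrating there and letting `w → 0` gives the claim; `R < Δ` leaves room for the
shift. -/
lemma IsSolutionOn.lyapunov_sub_le (h : IsSolutionOn F t₀ x₀ (Ici t₀) x)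
    (hLip : LocallyLipschitzUniformlyInTime F) {V : ℝ × EuclideanSpace ℝ (Fin n) → ℝ}
    {Y : EuclideanSpace ℝ (Fin n) × EuclideanSpace ℝ (Fin n) → ℝ} (hV : LocallyLipschitz V)
    (hY : Continuous Y) {Δ R : ℝ} {μ : NNReal} (hRΔ : R < Δ) (hR : ∀ t, t₀ ≤ t → ‖x t‖ ≤ R)
    (hF : ∀ᵐ t : ℝ, ∀ y, ‖y‖ < Δ → ‖F t y‖ ≤ μ)
    (hae : ∀ᵐ p : ℝ × EuclideanSpace ℝ (Fin n) ∂volume, ‖p.2‖ ≤ Δ →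
      totalDeriv F V p.1 p.2 ≤ Y (p.2, F p.1 p.2)) {b : ℝ} (hb : t₀ ≤ b) :
    V (b, x b) - V (t₀, x t₀) ≤ ∫ s in t₀..b, Y (x s, F s (x s)) := by
  have hbd : ∀ᵐ t : ℝ, t₀ ≤ t → ‖F t (x t)‖ ≤ μ := by
    filter_upwards [hF] with t ht ht0 using ht _ ((hR t ht0).trans_lt hRΔ)
  have hxL := h.lipschitzOnWith hbd
  have hR0 : 0 ≤ R := (norm_nonneg _).trans (hR t₀ le_rfl)
  -- `x` is arbitrary before `t₀`; freezing it there gives a curve continuous on all of `ℝ`.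
  set xh : ℝ → EuclideanSpace ℝ (Fin n) := fun s => x (max s t₀) with hxh
  have hxhx : ∀ s, t₀ ≤ s → xh s = x s := fun s hs => by simp [hxh, hs]
  have hxhc : Continuous xh :=
    hxL.continuousOn.comp_continuous (by fun_prop) fun s => mem_Ici.2 (le_max_right _ _)
  set B : Set (ℝ × EuclideanSpace ℝ (Fin n)) := Icc t₀ b ×ˢ Metric.closedBall 0 Δ with hB
  have hBc : IsCompact B := isCompact_Icc.prod (isCompact_closedBall _ _)
  obtain ⟨K, hK⟩ := hV.locallyLipschitzOn.exists_lipschitzOnWith_of_compact hBc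
  have hYint := h.intervalIntegrable_comp hY hR hbd hxL.continuousOn le_rfl hb
  have hgood : ∀ᵐ p : ℝ × EuclideanSpace ℝ (Fin n) ∂(volume.prod volume),
      (‖p.2‖ ≤ Δ → totalDeriv F V p.1 p.2 ≤ Y (p.2, F p.1 p.2)) ∧
      (p ∈ interior B → DifferentiableAt ℝ V p) := by
    rw [Measure.volume_eq_prod] at hae
    filter_upwards [hae, hK.ae_differentiableWithinAt_of_mem (μ := volume.prod volume)] with p h1 h2
    exact ⟨h1, fun hp =>
      (h2 (interior_subset hp)).differentiableAt (mem_interior_iff_mem_nhds.1 hp)⟩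
  have htrans := ae_ae_translate_mem hxhc hgood
  -- The first term collects the errors in the derivative, the second those at the two endpoints.
  set C : ℝ := (1 + K) * (b - t₀) + 2 * K with hC
  have hC0 : 0 ≤ C := by
    have := sub_nonneg.2 hb
    positivity
  have key : ∀ ε > 0, V (b, x b) - V (t₀, x t₀) ≤ (∫ s in t₀..b, Y (x s, F s (x s))) + ε * C := by
    intro ε hε
    obtain ⟨ρ₁, hρ₁, H₁⟩ := Metric.uniformContinuousOn_iff_le.1
      (((isCompact_closedBall (0 : EuclideanSpace ℝ (Fin n)) Δ).prod
        (isCompact_closedBall (0 : EuclideanSpace ℝ (Fin n)) μ)).uniformContinuousOn_of_continuous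
          hY.continuousOn) ε hε
    obtain ⟨ρ₂, hρ₂, H₂⟩ := hLip.exists_uniform_modulus Δ (lt_min hε hρ₁)
    obtain ⟨w, hw0, hw⟩ := (Measure.dense_of_ae htrans).inter_open_nonempty
      (Metric.ball 0 (min (min ρ₁ ρ₂) (min (Δ - R) ε))) Metric.isOpen_ball
      ⟨0, Metric.mem_ball_self (by have := sub_pos.2 hRΔ; positivity)⟩
    simp only [mem_ball_zero_iff, lt_min_iff] at hw0
    obtain ⟨⟨hw1, hw2⟩, hw3, hw4⟩ := hw0
    have hball : ∀ s, t₀ ≤ s → ‖x s + w‖ < Δ := fun s hs =>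
      (norm_add_le _ _).trans_lt (by linarith [hR s hs])
    have hball' : ∀ s, t₀ ≤ s → ‖x s‖ < Δ := fun s hs => (hR s hs).trans_lt hRΔ
    set g : ℝ → ℝ := fun s => V (s, x s + w) with hg
    have hgL : LipschitzOnWith (K * max 1 μ) g (Icc t₀ b) := by
      refine hK.comp (g := V) (f := fun s => (s, x s + w)) ?_ fun s hs =>
        ⟨hs, by simpa using (hball s hs.1).le⟩
      refine LipschitzOnWith.of_dist_le_mul fun s hs t ht => ?_
      rw [Prod.dist_eq, dist_add_right, NNReal.coe_max, max_mul_of_nonneg _ _ dist_nonneg]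
      exact max_le_max (by simp) (hxL.dist_le_mul s hs.1 t ht.1)
    have hac : AbsolutelyContinuousOnInterval g t₀ b :=
      LipschitzOnWith.absolutelyContinuousOnInterval (by rwa [uIcc_of_le hb])
    have hderiv : ∀ᵐ s : ℝ, s ∈ Ioo t₀ b → deriv g s ≤ Y (x s, F s (x s)) + (1 + K) * ε := by
      filter_upwards [hw, h.ae_hasDerivAt b, hF] with s hs hxs hFs hmem
      have hs0 : t₀ ≤ s := hmem.1.le
      rw [hxhx s hs0] at hs
      have hint : (s, x s + w) ∈ interior B := by
        rw [hB, interior_prod_eq, interior_Icc]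
        exact ⟨hmem, interior_mono Metric.ball_subset_closedBall
          (by rw [Metric.isOpen_ball.interior_eq]; simpa using hball s hs0)⟩
      have hVd := hs.2 hint
      have hVn : ‖fderiv ℝ V (s, x s + w)‖ ≤ K :=
        norm_fderiv_le_of_lipschitzOn ℝ (mem_interior_iff_mem_nhds.1 hint) hK
      have hgd : HasDerivAt g (fderiv ℝ V (s, x s + w) (1, F s (x s))) s :=
        hVd.hasFDerivAt.comp_hasDerivAt s ((hasDerivAt_id s).prodMk ((hxs hmem).add_const w))
      have hmod := H₂ (x s) (x s + w) (hball' s hs0).le (hball s hs0).le (by simpa using hw2.le) s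
      -- The shifted curve has velocity `F s (x s)`, not `F s (x s + w)`; the mismatch is small by
      -- the modulus of `F`.
      have hsplit : fderiv ℝ V (s, x s + w) (1, F s (x s)) = totalDeriv F V s (x s + w) +
          fderiv ℝ V (s, x s + w) (0, F s (x s) - F s (x s + w)) := by
        rw [totalDeriv_eq_fderiv hVd, ← map_add]
        simp
      have hrem : fderiv ℝ V (s, x s + w) (0, F s (x s) - F s (x s + w)) ≤ K * ε := by
        refine (Real.le_norm_self _).trans ((ContinuousLinearMap.le_opNorm _ _).trans ?_)
        refine mul_le_mul hVn ?_ (norm_nonneg _) K.2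
        rw [Prod.norm_mk, norm_zero]
        exact max_le hε.le (hmod.trans (min_le_left _ _))
      have hYY : Y (x s + w, F s (x s + w)) ≤ Y (x s, F s (x s)) + ε := by
        have := H₁ (x s + w, F s (x s + w))
          ⟨by simpa using (hball s hs0).le, by simpa using hFs _ (hball s hs0)⟩ (x s, F s (x s))
          ⟨by simpa using (hball' s hs0).le, by simpa using hFs _ (hball' s hs0)⟩ (by
            rw [Prod.dist_eq]
            refine max_le (by simpa using hw1.le) ?_
            rw [dist_comm, dist_eq_norm]
            exact hmod.trans (min_le_right _ _))
        rw [Real.dist_eq] at this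
        linarith [le_abs_self (Y (x s + w, F s (x s + w)) - Y (x s, F s (x s)))]
      have := hs.1 (hball s hs0).le
      rw [hgd.deriv, hsplit]
      linarith
    have hle : g b - g t₀ ≤ (∫ s in t₀..b, Y (x s, F s (x s))) + (1 + K) * ε * (b - t₀) := by
      have h1 : ∫ s in t₀..b, (Y (x s, F s (x s)) + (1 + K) * ε) =
          (∫ s in t₀..b, Y (x s, F s (x s))) + (1 + K) * ε * (b - t₀) := by
        rw [intervalIntegral.integral_add hYint intervalIntegrable_const,
          intervalIntegral.integral_const, smul_eq_mul]
        ring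
      rw [← hac.integral_deriv_eq_sub, ← h1]
      refine intervalIntegral.integral_mono_ae_restrict hb hac.intervalIntegrable_deriv
        (hYint.add intervalIntegrable_const) ?_
      rw [← restrict_Ioo_eq_restrict_Icc]
      exact (ae_restrict_iff' measurableSet_Ioo).2 hderiv
    have hend : ∀ s ∈ Icc t₀ b, |g s - V (s, x s)| ≤ K * ε := by
      intro s hs
      have := hK.dist_le_mul (s, x s + w) ⟨hs, by simpa using (hball s hs.1).le⟩ (s, x s)
        ⟨hs, by simpa using (hball' s hs.1).le⟩
      rw [Real.dist_eq, Prod.dist_eq, dist_self, dist_self_add_left,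
        max_eq_right (norm_nonneg _)] at this
      exact this.trans (mul_le_mul_of_nonneg_left hw4.le K.2)
    have e1 := abs_le.1 (hend b (right_mem_Icc.2 hb))
    have e2 := abs_le.1 (hend t₀ (left_mem_Icc.2 hb))
    have : ε * C = (1 + K) * ε * (b - t₀) + 2 * (K * ε) := by rw [hC]; ring
    linarith [e1.1, e2.2]
  refine le_of_forall_pos_le_add fun δ hδ => (key (δ / (C + 1)) (by positivity)).trans ?_
  have : δ / (C + 1) * C ≤ δ := by
    rw [div_mul_eq_mul_div, div_le_iff₀ (by positivity)]
    nlinarith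
  linarith

/-- Persistent excitation at the state from which the solution starts a window transfers to the
solution on that window. -/
lemma IsSolutionOn.le_integral_norm (h : IsSolutionOn F t₀ x₀ (Ici t₀) x)
    (hint : ∀ z, LocallyIntegrable (fun t => F t z) volume) {R ρ c T : ℝ} (hT : 0 < T)
    (hR : ∀ t, t₀ ≤ t → ‖x t‖ ≤ R)
    (hmod : ∀ y z : EuclideanSpace ℝ (Fin n), ‖y‖ ≤ R → ‖z‖ ≤ R → ‖y - z‖ ≤ ρ →
      ∀ t, ‖F t y - F t z‖ ≤ c / (2 * T)) {t : ℝ} (ht : t₀ ≤ t)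
    (hpe : c ≤ ∫ τ in t..(t + T), ‖F τ (x t)‖) :
    min ρ (c / 2) ≤ ∫ τ in t..(t + T), ‖F τ (x τ)‖ := by
  -- A path shorter than `ρ` stays where `hmod` applies, so freezing the state costs at most `T * (c
  -- / (2 * T)) = c / 2`.
  by_contra! hlt
  obtain ⟨hlt1, hlt2⟩ := lt_min_iff.1 hlt
  have htT : t ≤ t + T := by linarith
  have hFi := (h.intervalIntegrable_of_le ht (ht.trans htT)).norm
  have hclose : ∀ s ∈ Icc t (t + T), ‖x t - x s‖ ≤ ρ := by
    intro s hs
    rw [norm_sub_rev, h.sub_eq_integral ht (ht.trans hs.1)]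
    refine (intervalIntegral.norm_integral_le_integral_norm hs.1).trans
      ((intervalIntegral.integral_mono_interval le_rfl hs.1 hs.2
        (Eventually.of_forall fun _ => norm_nonneg _) hFi).trans hlt1.le)
  have hle : ∫ τ in t..(t + T), ‖F τ (x t)‖ ≤
      ∫ τ in t..(t + T), (‖F τ (x τ)‖ + c / (2 * T)) := by
    refine intervalIntegral.integral_mono_on htT
      (((hint (x t)).integrableOn_isCompact isCompact_uIcc).intervalIntegrable.norm)
      (hFi.add intervalIntegrable_const) fun s hs => ?_
    have h1 := hmod (x t) (x s) (hR t ht) (hR s (ht.trans hs.1)) (hclose s hs) s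
    have h2 := norm_sub_norm_le (F s (x t)) (F s (x s))
    linarith
  rw [intervalIntegral.integral_add hFi intervalIntegrable_const, intervalIntegral.integral_const,
    smul_eq_mul, add_sub_cancel_left] at hle
  have : T * (c / (2 * T)) = c / 2 := by field_simp
  linarith

end Lyapunov

/-! ### Uniform attractivity -/

lemma IsClassKInfty.exists_pos_le {γ : ℝ → ℝ} (hγ : IsClassKInfty γ) {σ : ℝ} (hσ : 0 < σ) :
    ∃ η > 0, γ η ≤ σ := by
  have h0 : Tendsto γ (𝓝[>] 0) (𝓝 0) := by
    have := (hγ.continuousOn 0 self_mem_Ici).tendsto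
    rw [hγ.map_zero] at this
    exact this.mono_left (nhdsWithin_mono _ Ioi_subset_Ici_self)
  obtain ⟨η, h1, h2⟩ :=
    ((h0.eventually (gt_mem_nhds hσ)).and self_mem_nhdsWithin).exists
  exact ⟨η, h2, h1.le⟩

theorem mainTheorem3 (n : ℕ)
    (F : ℝ → EuclideanSpace ℝ (Fin n) → EuclideanSpace ℝ (Fin n))
    (hUGS : IsUGS F)
    (hV : ∀ Δ > (0 : ℝ), ∃ μ > (0 : ℝ),
      ∃ V : ℝ × EuclideanSpace ℝ (Fin n) → ℝ,
      ∃ Y : EuclideanSpace ℝ (Fin n) × EuclideanSpace ℝ (Fin n) → ℝ,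
        LocallyLipschitz V ∧ Continuous Y ∧
        (∀ᵐ p : ℝ × EuclideanSpace ℝ (Fin n) ∂volume, ‖p.2‖ ≤ Δ →
          max |V p| ‖F p.1 p.2‖ ≤ μ ∧ totalDeriv F V p.1 p.2 ≤ Y (p.2, F p.1 p.2)) ∧
        (∀ z ψ : EuclideanSpace ℝ (Fin n), ‖z‖ ≤ Δ → ‖ψ‖ ≤ μ → Y (z, ψ) ≤ 0) ∧
        (∀ z ψ : EuclideanSpace ℝ (Fin n), ‖z‖ ≤ Δ → ‖ψ‖ ≤ μ → Y (z, ψ) = 0 → ψ = 0))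
    (hLip : LocallyLipschitzUniformlyInTime F)
    (hPE : IsUDeltaPE F) :
    IsUGAS F := by
  refine ⟨hUGS, fun r hr σ hσ => ?_⟩
  obtain ⟨-, γ, hγ, hbound⟩ := hUGS
  obtain ⟨η, hη, hησ⟩ := hγ.exists_pos_le hσ
  set R := γ r with hRdef
  have hR0 : 0 ≤ R := by
    rw [← hγ.map_zero]
    exact hγ.strictMonoOn.monotoneOn self_mem_Ici hr.le hr.le
  obtain ⟨μ, hμ, V, Y, hVlip, hY, hae, hYneg, hYzero⟩ := hV (R + 1) (by linarith)
  have hRΔ : R < R + 1 := by linarith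
  have hF : ∀ᵐ t : ℝ, ∀ y, ‖y‖ < R + 1 → ‖F t y‖ ≤ μ :=
    ae_forall_norm_le hLip (by
      filter_upwards [hae] with p hp hpn using (le_max_right _ _).trans (hp hpn).1)
  have hVle : ∀ p ∈ {p : ℝ × EuclideanSpace ℝ (Fin n) | ‖p.2‖ < R + 1}, |V p| ≤ μ :=
    forall_mem_le_of_ae (ν := volume) (by simpa using hVlip.continuous.abs)
      (isOpen_lt (by fun_prop) continuous_const) (by
        filter_upwards [hae] with p hp hpn
          using (le_max_left _ _).trans (hp (le_of_lt hpn)).1)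
  obtain ⟨T, hT, c, hc, hpe⟩ := hPE.exists_uniform_of_annulus hη R
  obtain ⟨ρ, hρ, hmod⟩ := hLip.exists_uniform_modulus R (ε := c / (2 * T)) (by positivity)
  set a := min ρ (c / 2) with ha
  have ha0 : 0 < a := by positivity
  -- Over a window this `ε` uses up `a / 2`, leaving the other half to be paid by `-Y`.
  obtain ⟨K, hK, hKle⟩ := exists_norm_le_add_mul hY hYneg hYzero (ε := a / (2 * T)) (by positivity)
  -- `V` can drop by at most `2 * μ`, and each window costs `a / (2 * K)`.
  obtain ⟨N, hN⟩ := exists_nat_gt (2 * μ / (a / (2 * K)))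
  refine ⟨(N + 1) * T, by positivity, fun t₀ x₀ x hsol hx₀ t ht => ?_⟩
  have hxR : ∀ t, t₀ ≤ t → ‖x t‖ ≤ R := fun t ht =>
    (hbound t₀ x₀ x hsol t ht).trans
      (hγ.strictMonoOn.monotoneOn (norm_nonneg _) hr.le hx₀)
  have hbd : ∀ᵐ t : ℝ, t₀ ≤ t → ‖F t (x t)‖ ≤ μ := by
    filter_upwards [hF] with t ht ht0 using ht _ ((hxR t ht0).trans_lt hRΔ)
  have hxc : ContinuousOn x (Ici t₀) :=
    (hsol.lipschitzOnWith (μ := ⟨μ, hμ.le⟩) hbd).continuousOn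
  -- It suffices that the solution enters the ball of radius `η`.
  suffices hent : ∃ s, t₀ ≤ s ∧ s ≤ t₀ + (N + 1) * T ∧ ‖x s‖ < η by
    obtain ⟨s, hs0, hsT, hs⟩ := hent
    exact (hbound s (x s) x (hsol.restart hs0) t (hsT.trans ht)).trans
      ((hγ.strictMonoOn.monotoneOn (norm_nonneg _) hη.le hs.le).trans hησ)
  by_contra! hout
  have hYi : ∀ {s t : ℝ}, t₀ ≤ s → t₀ ≤ t →
      IntervalIntegrable (fun τ => Y (x τ, F τ (x τ))) volume s t :=
    fun hs ht => hsol.intervalIntegrable_comp hY hxR hbd hxc hs ht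
  have hwindow : ∀ s, t₀ ≤ s → η ≤ ‖x s‖ →
      ∫ τ in s..(s + T), Y (x τ, F τ (x τ)) ≤ -(a / (2 * K)) := by
    intro s hs hsη
    have hsT : t₀ ≤ s + T := by linarith
    have h1 : a ≤ ∫ τ in s..(s + T), ‖F τ (x τ)‖ :=
      hsol.le_integral_norm hPE.1 hT hxR hmod hs (hpe (x s) hsη (hxR s hs) s)
    have hKi : IntervalIntegrable (fun τ => K * -Y (x τ, F τ (x τ))) volume s (s + T) :=
      (hYi hs hsT).neg.const_mul K
    have h2 : ∫ τ in s..(s + T), ‖F τ (x τ)‖ ≤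
        ∫ τ in s..(s + T), (a / (2 * T) + K * -Y (x τ, F τ (x τ))) := by
      refine intervalIntegral.integral_mono_ae_restrict (by linarith)
        (hsol.intervalIntegrable_of_le hs hsT).norm
        (intervalIntegrable_const.add hKi) ?_
      filter_upwards [ae_restrict_of_ae hbd, ae_restrict_mem measurableSet_Icc] with τ h1 h2
      have hτ : t₀ ≤ τ := hs.trans h2.1
      exact hKle _ _ ((hxR τ hτ).trans hRΔ.le) (h1 hτ)
    rw [intervalIntegral.integral_add intervalIntegrable_const hKi,
      intervalIntegral.integral_const, intervalIntegral.integral_const_mul,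
      intervalIntegral.integral_neg, smul_eq_mul, add_sub_cancel_left] at h2
    have h3 : T * (a / (2 * T)) = a / 2 := by field_simp
    have h4 : a / (2 * K) = (a / 2) / K := by field_simp
    rw [h4, le_neg, div_le_iff₀ hK]
    linarith
  have hsum : ∀ k : ℕ, k ≤ N →
      ∫ τ in t₀..(t₀ + k * T), Y (x τ, F τ (x τ)) ≤ -(k * (a / (2 * K))) := by
    intro k
    induction k with
    | zero => simp
    | succ k ih =>
      intro hk
      have hkT : t₀ ≤ t₀ + k * T := le_add_of_nonneg_right (by positivity)
      have hkT' : t₀ + k * T ≤ t₀ + (N + 1) * T := by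
        have : (k : ℝ) ≤ N + 1 := by exact_mod_cast (by omega : k ≤ N + 1)
        gcongr
      have h1 := hwindow _ hkT (hout _ hkT hkT')
      have h2 := ih (by omega)
      rw [show t₀ + ((k + 1 : ℕ) : ℝ) * T = t₀ + k * T + T by push_cast; ring,
        ← intervalIntegral.integral_add_adjacent_intervals (hYi le_rfl hkT)
          (hYi hkT (by linarith))]
      push_cast
      linarith
  have hNT : t₀ ≤ t₀ + N * T := le_add_of_nonneg_right (by positivity)
  have hdec := hsol.lyapunov_sub_le (μ := ⟨μ, hμ.le⟩) hLip hVlip hY hRΔ hxR hF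
    (by filter_upwards [hae] with p hp hpn using (hp hpn).2) hNT
  have hV1 := abs_le.1 (hVle (t₀ + N * T, x (t₀ + N * T)) ((hxR _ hNT).trans_lt hRΔ))
  have hV2 := abs_le.1 (hVle (t₀, x t₀) ((hxR _ le_rfl).trans_lt hRΔ))
  have hfin := hsum N le_rfl
  have := (div_lt_iff₀ (by positivity)).1 hN
  linarith [hV1.1, hV2.2]
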